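/- Let $\mathbb D$, $\mathbb T$ be the open unit disc and the unit circle, and let $\Gamma=\{(z+w,zw):|z|\le1,|w|\le1\}\subset\mathbb C^2$, $\mathcal G=\{(z+w,zw):|z|<1,|w|<1\}$, $b\Gamma=\{(z+w,zw):|z|=|w|=1\}$ (the distinguished boundary of $\Gamma$), and $\mathcal R=\{(2z,z^2):z\in\mathbb C\}$. A rational $\Gamma$-inner function is a pair $h=(s,p)$ of rational functions that defines a holomorphic map from $\mathbb D$ to $\Gamma$ whose boundary values at almost all points of $\mathbb T$ lie in $b\Gamma$; it extends continuously to $\overline{\mathbb D}$ and maps $\mathbb T$ into $b\Gamma$. Its degree is the integer $n$ that is the class of $h|_{\mathbb T}$ in $\pi_1(b\Gamma)\cong\mathbb Z$ ($b\Gamma$ is a Möbius band; the generator is the class of the loop $z\mapsto(0,z)$), that is, $h|_{\mathbb T}$ is homotopic in $b\Gamma$ to $z\mapsto(0,z^n)$. The function $h$ is superficial if $h(\mathbb D)\subset\partial\Gamma$ (the topological boundary), and a royal node of $h$ is a point $\sigma\in\overline{\mathbb D}$ with $h(\sigma)\in\mathcal R$. For a set $G\subset\mathbb C^2$, a holomorphic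 map $h:\mathbb D\to G$ is $N$-extremal in $\mathrm{hol}(\mathbb D,G)$ if for every choice of $N$ distinct points $\lambda_1,\dots,\lambda_N\in\mathbb D$ there do not exist an open neighbourhood $U$ of $\overline{\mathbb D}$ and a holomorphic map $g:U\to G$ with $g(\lambda_j)=h(\lambda_j)$ for $j=1,\dots,N$. For a domain $G\subset\mathbb C^2$, a holomorphic map $h:\mathbb D\to G$ is an $m$-complex geodesic of $G$ if there is a holomorphic map $F:G\to\mathbb D$ such that $F\circ h$ is a finite Blaschke product of degree at most $m$. Let $h$ be a rational $\Gamma$-inner function of degree $n$ that is not superficial and satisfies $h(\mathbb D)\not\subset\mathcal R$. Then: (i) $h$ is $(n+1)$-extremal in $\mathrm{hol}(\mathbb D,\Gamma)$, and $h$ maps $\mathbb D$ into $\mathcal G$ and is an $n$-complex geodesic of $\mathcal G$; (ii) if in addition $h$ has at least one royal node $\sigma\in\mathbb T$, then $n\ge1$, $h$ is $n$-extremal in $\mathrm{hol}(\mathbb D,\Gamma)$ and $h$ is an $(n-1)$-complex geodesic of $\mathcal G$. -/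

import Mathlib

open Set Filter Topology Metric

noncomputable section

namespace SymBidisc

/-- The open unit disc `𝔻`. -/
def disc : Set ℂ := ball 0 1

/-- The closed symmetrized bidisc `Γ`. -/
def Gam : Set (ℂ × ℂ) := {x | ∃ z w : ℂ, ‖z‖ ≤ 1 ∧ ‖w‖ ≤ 1 ∧ x = (z + w, z * w)}

/-- The open symmetrized bidisc `𝒢`. -/
def openGam : Set (ℂ × ℂ) := {x | ∃ z w : ℂ, ‖z‖ < 1 ∧ ‖w‖ < 1 ∧ x = (z + w, z * w)}

/-- The distinguished boundary `bΓ` of `Γ`: the symmetrization of the 2-torus. -/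
def bGam : Set (ℂ × ℂ) := {x | ∃ z w : ℂ, ‖z‖ = 1 ∧ ‖w‖ = 1 ∧ x = (z + w, z * w)}

/-- The royal variety `𝓡`. -/
def royal : Set (ℂ × ℂ) := {x | ∃ z : ℂ, x = (2 * z, z ^ 2)}

/-- `f` is a holomorphic map from the open set `U` to the (open or closed) set `G`. -/
def IsHol {E F : Type*} [NormedAddCommGroup E] [NormedSpace ℂ E]
    [NormedAddCommGroup F] [NormedSpace ℂ F] (U : Set E) (G : Set F) (f : E → F) : Prop :=
  DifferentiableOn ℂ f U ∧ MapsTo f U G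

/-- `h` is a `Γ`-inner function: a holomorphic map from `𝔻` to `Γ` whose boundary values (radial
limits) exist and belong to `bΓ` at almost every point of the unit circle. -/
def IsGammaInner (h : ℂ → ℂ × ℂ) : Prop :=
  IsHol disc Gam h ∧
    ∀ᵐ θ : ℝ, ∃ w ∈ bGam,
      Tendsto (fun r : ℝ => h (r * Complex.exp (θ * Complex.I))) (𝓝[<] 1) (𝓝 w)

/-- The map `(s, p)` given by two rational functions. It is evaluated in lowest terms, so that a
map which is bounded on `𝔻` is automatically evaluated continuously on the closed disc. -/
def ratMap (s p : RatFunc ℂ) : ℂ → ℂ × ℂ :=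
  fun z => (s.eval (RingHom.id ℂ) z, p.eval (RingHom.id ℂ) z)

theorem core_mem (u : Circle) : ((0 : ℂ), (u : ℂ)) ∈ bGam := by
  obtain ⟨z, hz⟩ := IsAlgClosed.exists_pow_nat_eq (-(u : ℂ)) (n := 2) (by norm_num)
  have h1 : ‖z‖ = 1 := by
    have h2 : ‖z‖ ^ 2 = 1 := by rw [← norm_pow, hz, norm_neg, Circle.norm_coe]
    exact (pow_eq_one_iff_of_nonneg (norm_nonneg z) (by norm_num)).1 h2
  refine ⟨z, -z, h1, by rw [norm_neg, h1], ?_⟩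
  ext
  · simp
  · have h3 : z * -z = -(z ^ 2) := by ring
    simp [h3, hz]

/-- The loop `z ↦ (0, z ^ n)` in `bΓ`. For `n = 1` this is the core circle of the Möbius band
`bΓ`, whose class generates `π₁(bΓ) ≅ ℤ`, so the loop represents `n ∈ π₁(bΓ)`. -/
def coreLoop (n : ℤ) : C(Circle, bGam) where
  toFun z := ⟨((0 : ℂ), ((z ^ n : Circle) : ℂ)), core_mem (z ^ n)⟩
  continuous_toFun := by
    refine Continuous.subtype_mk ?_ _
    have h : Continuous fun z : Circle => z ^ n := continuous_zpow n
    have h' : Continuous fun z : Circle => (z : ℂ) := by fun_prop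
    exact continuous_const.prodMk (h'.comp h)

/-- `h` has degree `n`: it restricts to a continuous map from `𝕋` to `bΓ` whose class in
`π₁(bΓ) ≅ ℤ` is `n`. As `π₁(bΓ)` is abelian, this class is determined by free homotopy. -/
def HasDegree (h : ℂ → ℂ × ℂ) (n : ℤ) : Prop :=
  ∃ f : C(Circle, bGam), (∀ z : Circle, (f z : ℂ × ℂ) = h z) ∧ f.Homotopic (coreLoop n)

/-- `h` is superficial: it maps `𝔻` into the topological boundary of `Γ`. -/
def IsSuperficial (h : ℂ → ℂ × ℂ) : Prop := MapsTo h disc (frontier Gam)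

/-- `σ` is a royal node of `h`. -/
def IsRoyalNode (h : ℂ → ℂ × ℂ) (σ : ℂ) : Prop := σ ∈ closedBall (0 : ℂ) 1 ∧ h σ ∈ royal

/-- The data `lam j ↦ z j` are solvable in `hol(𝔻, G)`. -/
def IsSolvable {n : ℕ} (G : Set (ℂ × ℂ)) (lam : Fin n → ℂ) (z : Fin n → ℂ × ℂ) : Prop :=
  ∃ g : ℂ → ℂ × ℂ, IsHol disc G g ∧ ∀ j, g (lam j) = z j

/-- The data `lam j ↦ z j` are extremal: solvable, but not by a map that is holomorphic from an
open neighbourhood of the closed disc to `G`. -/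
def IsExtremalData {n : ℕ} (G : Set (ℂ × ℂ)) (lam : Fin n → ℂ) (z : Fin n → ℂ × ℂ) : Prop :=
  IsSolvable G lam z ∧
    ¬ ∃ U : Set ℂ, IsOpen U ∧ closure disc ⊆ U ∧
      ∃ g : ℂ → ℂ × ℂ, IsHol U G g ∧ ∀ j, g (lam j) = z j

/-- `h` is an `n`-extremal map in `hol(𝔻, G)`. -/
def IsExtremal (G : Set (ℂ × ℂ)) (n : ℕ) (h : ℂ → ℂ × ℂ) : Prop :=
  IsHol disc G h ∧
    ∀ lam : Fin n → ℂ, Function.Injective lam → (∀ j, lam j ∈ disc) →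
      IsExtremalData G lam (fun j => h (lam j))

/-- `f` is, on `𝔻`, a finite Blaschke product of degree `d`. -/
def IsBlaschke (d : ℕ) (f : ℂ → ℂ) : Prop :=
  ∃ (c : ℂ) (α : Fin d → ℂ), ‖c‖ = 1 ∧ (∀ j, α j ∈ disc) ∧
    ∀ z ∈ disc, f z = c * ∏ j, (z - α j) / (1 - starRingEnd ℂ (α j) * z)

/-- `h` is an `m`-complex geodesic of the domain `G`. -/
def IsComplexGeodesic (G : Set (ℂ × ℂ)) (m : ℕ) (h : ℂ → ℂ × ℂ) : Prop :=
  IsHol disc G h ∧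
    ∃ F : ℂ × ℂ → ℂ, IsHol G disc F ∧ ∃ d ≤ m, IsBlaschke d (F ∘ h)

end SymBidisc

end

namespace SymBidisc

open Polynomial

/-! For `|ω| = 1` the function `magic ω`, i.e. `Φ_ω`, maps `𝒢` holomorphically into `𝔻`, and it
witnesses both conclusions at once: if `Φ_ω ∘ h` is a Blaschke product of degree `d`, then `h` is a
`d`-complex geodesic and is `N`-extremal for every `N > d`. For extremality, an interpolant `g`
holomorphic near the closed disc would give `Φ_ω ∘ g` of modulus less than one near the closed disc,
agreeing with the Blaschke product at more than `d` points; `card_le_of_eqOn_isBlaschke` forbids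
this.

To bound `d`, write `p = N / D` and `s = T / D` with `D̃ = e N`, `T̃ = e T`, `|e| = 1`, where `~` is
conjugate reversal at level `n`, the degree of `h` (`exists_conjRev_eq`, `exists_common_denom`,
`degree_eq_of_conjRev`). Then `Φ_ω ∘ h` is a unimodular multiple of `B̃ / B` with `B = 2D - ωT`, so
`d ≤ n`. A royal node on the circle, where `h = (2ζ, ζ²)` with `|ζ| = 1`, makes `B` vanish there for
`ω = conj ζ`, and the resulting cancellation lowers `d` by at least one. -/

/-! ### Winding numbers of loops in the circle -/

theorem eq_of_circleExp_comp_const {A : Type*} [TopologicalSpace A] [PreconnectedSpace A]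
    {φ : A → ℝ} (hφ : Continuous φ) {c : Circle} (h : ∀ a, Circle.exp (φ a) = c) (a b : A) :
    φ a = φ b :=
  congrFun (Circle.isCoveringMap_exp.eq_of_comp_eq hφ (continuous_const (y := φ b))
    (by ext x; simp [h]) b rfl) a

/-- Homotopic loops `z ↦ c z ^ m` and `z ↦ z ^ n` in the circle have the same exponent. -/
theorem eq_of_homotopic_zpow {f g : C(Circle, Circle)} {c : Circle} {m n : ℤ}
    (hf : ∀ z, f z = c * z ^ m) (hg : ∀ z, g z = z ^ n) (h : f.Homotopic g) : m = n := by
  obtain ⟨H⟩ := h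
  -- Extending the homotopy to the simply connected plane gives a global lift `F`. The increment `F
  -- (t, 2π) - F (t, 0)` has trivial exponential, so it is constant in `t`; it is `2πm` at `t = 0`
  -- and `2πn` at `t = 1`.
  let K : C(ℝ × ℝ, Circle) :=
    ⟨fun x => H (projIcc 0 1 zero_le_one x.1, Circle.exp x.2), by fun_prop⟩
  obtain ⟨a, ha⟩ := Circle.exp_surjective (K 0)
  obtain ⟨F, ⟨-, hF⟩, -⟩ := Circle.isCoveringMap_exp.existsUnique_continuousMap_lifts K 0 a ha
  have hF' : ∀ t x : ℝ, Circle.exp (F (t, x)) = K (t, x) := fun t x => congrFun hF (t, x)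
  have hz : ∀ (k : ℤ) (x : ℝ), Circle.exp (k * x) = Circle.exp x ^ k := fun k x => by
    rw [← zsmul_eq_mul, Circle.exp_zsmul]
  have h0 : ∀ x, Circle.exp (F (0, x) - m * x) = c := fun x => by
    rw [Circle.exp_sub, hF', hz]
    simp [K, hf]
  have h1 : ∀ x, Circle.exp (F (1, x) - n * x) = 1 := fun x => by
    rw [Circle.exp_sub, hF', hz]
    simp [K, hg]
  have h2 : ∀ t, Circle.exp (F (t, 2 * Real.pi) - F (t, 0)) = 1 := fun t => by
    rw [Circle.exp_sub, hF', hF']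
    simp [K]
  have e0 := eq_of_circleExp_comp_const (by fun_prop) h0 (2 * Real.pi) 0
  have e1 := eq_of_circleExp_comp_const (by fun_prop) h1 (2 * Real.pi) 0
  have e2 := eq_of_circleExp_comp_const (by fun_prop) h2 0 1
  have e3 : (m : ℝ) * (2 * Real.pi) = n * (2 * Real.pi) := by linarith
  exact_mod_cast mul_right_cancel₀ Real.two_pi_pos.ne' e3

/-! ### The functions `Φ_ω` and holomorphic maps into `Γ` -/

/-- The rational function `Φ_ω (s, p) = (2 ω p - s) / (2 - ω s)`. -/
noncomputable def magic (ω : ℂ) (x : ℂ × ℂ) : ℂ := (2 * ω * x.2 - x.1) / (2 - ω * x.1)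

/-- With `a = ωz`, `b = ωw` the left side compares denominator and numerator of `Φ_ω (z + w, zw)`;
the right side makes its sign visible. -/
theorem normSq_magic_identity (a b : ℂ) :
    ‖2 - (a + b)‖ ^ 2 - ‖2 * (a * b) - (a + b)‖ ^ 2 =
      2 * (‖1 - a‖ ^ 2 * (1 - ‖b‖ ^ 2) + ‖1 - b‖ ^ 2 * (1 - ‖a‖ ^ 2)) := by
  simp only [← Complex.normSq_eq_norm_sq, Complex.normSq_apply, Complex.sub_re, Complex.sub_im,
    Complex.add_re, Complex.add_im, Complex.mul_re, Complex.mul_im, Complex.one_re,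
    Complex.one_im, Complex.re_ofNat, Complex.im_ofNat]
  ring

theorem norm_magic_num_le {ω : ℂ} (hω : ‖ω‖ = 1) {x : ℂ × ℂ} (hx : x ∈ Gam) :
    ‖2 * ω * x.2 - x.1‖ ≤ ‖2 - ω * x.1‖ := by
  obtain ⟨z, w, hz, hw, rfl⟩ := hx
  have h := normSq_magic_identity (ω * z) (ω * w)
  have e : ‖2 * ω * (z * w) - (z + w)‖ = ‖2 * (ω * z * (ω * w)) - (ω * z + ω * w)‖ := by
    rw [show 2 * (ω * z * (ω * w)) - (ω * z + ω * w) = ω * (2 * ω * (z * w) - (z + w)) by ring,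
      norm_mul, hω, one_mul]
  simp only
  rw [e, mul_add, ← sq_le_sq₀ (norm_nonneg _) (norm_nonneg _), ← sub_nonneg, h]
  simp only [norm_mul, hω, one_mul]
  have := pow_le_one₀ (n := 2) (norm_nonneg z) hz
  have := pow_le_one₀ (n := 2) (norm_nonneg w) hw
  have h1 := mul_nonneg (sq_nonneg ‖1 - ω * z‖) (sub_nonneg.2 ‹‖w‖ ^ 2 ≤ 1›)
  have h2 := mul_nonneg (sq_nonneg ‖1 - ω * w‖) (sub_nonneg.2 ‹‖z‖ ^ 2 ≤ 1›)
  linarith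

theorem norm_magic_le {ω : ℂ} (hω : ‖ω‖ = 1) {x : ℂ × ℂ} (hx : x ∈ Gam) : ‖magic ω x‖ ≤ 1 := by
  rw [magic, norm_div]
  exact div_le_one_of_le₀ (norm_magic_num_le hω hx) (norm_nonneg _)

theorem norm_fst_le {x : ℂ × ℂ} (hx : x ∈ Gam) : ‖x.1‖ ≤ 2 := by
  obtain ⟨z, w, hz, hw, rfl⟩ := hx
  exact (norm_add_le z w).trans (by linarith)

theorem norm_snd_le {x : ℂ × ℂ} (hx : x ∈ Gam) : ‖x.2‖ ≤ 1 := by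
  obtain ⟨z, w, hz, hw, rfl⟩ := hx
  simpa using mul_le_one₀ hz (norm_nonneg w) hw

theorem norm_fst_lt {x : ℂ × ℂ} (hx : x ∈ openGam) : ‖x.1‖ < 2 := by
  obtain ⟨z, w, hz, hw, rfl⟩ := hx
  exact (norm_add_le z w).trans_lt (by linarith)

theorem two_sub_ne_zero {ω a : ℂ} (hω : ‖ω‖ = 1) (ha : ‖a‖ < 2) : 2 - ω * a ≠ 0 := by
  intro h
  have h1 : ‖ω * a‖ = 2 := by rw [← sub_eq_zero.1 h]; simp
  rw [norm_mul, hω, one_mul] at h1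
  linarith

theorem norm_magic_lt {ω : ℂ} (hω : ‖ω‖ = 1) {x : ℂ × ℂ} (hx : x ∈ openGam) :
    ‖magic ω x‖ < 1 := by
  have hd := two_sub_ne_zero hω (norm_fst_lt hx)
  rw [magic, norm_div, div_lt_one (norm_pos_iff.2 hd)]
  obtain ⟨z, w, hz, hw, rfl⟩ := hx
  have h := normSq_magic_identity (ω * z) (ω * w)
  have e : ‖2 * ω * (z * w) - (z + w)‖ = ‖2 * (ω * z * (ω * w)) - (ω * z + ω * w)‖ := by
    rw [show 2 * (ω * z * (ω * w)) - (ω * z + ω * w) = ω * (2 * ω * (z * w) - (z + w)) by ring,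
      norm_mul, hω, one_mul]
  simp only
  rw [e, mul_add, ← sq_lt_sq₀ (norm_nonneg _) (norm_nonneg _), ← sub_pos, h]
  have hz' : ‖ω * z‖ < 1 := by rwa [norm_mul, hω, one_mul]
  have hw' : ‖ω * w‖ < 1 := by rwa [norm_mul, hω, one_mul]
  have pos : ∀ u : ℂ, ‖u‖ < 1 → 0 < 1 - ‖u‖ ^ 2 ∧ 0 < ‖1 - u‖ ^ 2 := fun u hu => by
    refine ⟨sub_pos.2 (pow_lt_one₀ (norm_nonneg u) hu two_ne_zero), ?_⟩
    have : 1 - u ≠ 0 := fun h0 => by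
      rw [← sub_eq_zero.1 h0, norm_one] at hu
      exact lt_irrefl _ hu
    positivity
  have h1 := mul_pos (pos _ hz').2 (pos _ hw').1
  have h2 := mul_pos (pos _ hw').2 (pos _ hz').1
  linarith

theorem differentiableOn_magic {ω : ℂ} (hω : ‖ω‖ = 1) :
    DifferentiableOn ℂ (magic ω) {x | ‖x.1‖ < 2} := fun x hx => by
  have h1 : DifferentiableAt ℂ (fun x : ℂ × ℂ => 2 * ω * x.2 - x.1) x := by fun_prop
  have h2 : DifferentiableAt ℂ (fun x : ℂ × ℂ => 2 - ω * x.1) x := by fun_prop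
  unfold magic
  simp only [div_eq_mul_inv]
  exact (h1.mul (h2.inv (two_sub_ne_zero hω hx))).differentiableWithinAt

/-- A holomorphic map into `Γ` that meets `𝒢` stays in `𝒢`. -/
theorem mapsTo_openGam {V : Set ℂ} (hV : IsOpen V) (hc : IsPreconnected V) {h : ℂ → ℂ × ℂ}
    (hh : IsHol V Gam h) {a : ℂ} (ha : a ∈ V) (hah : h a ∈ openGam) : MapsTo h V openGam := by
  -- The maximum principle for `s` comes first, since `Φ_ω ∘ h` is known to be holomorphic only
  -- where `|s| < 2`.
  have hs : MapsTo h V {x | ‖x.1‖ < 2} := by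
    intro b hb
    refine lt_of_le_of_ne (norm_fst_le (hh.2 hb)) fun h2 => ?_
    have hm : IsMaxOn (norm ∘ fun z => (h z).1) V b := fun z hz => by
      simpa [h2] using norm_fst_le (hh.2 hz)
    have e := Complex.norm_eqOn_of_isPreconnected_of_isMaxOn hc hV hh.1.fst hb hm ha
    simp only [Function.comp, Function.const] at e
    linarith [norm_fst_lt hah]
  have key : ∀ ω : ℂ, ‖ω‖ = 1 → ∀ b ∈ V, ‖magic ω (h b)‖ ≠ 1 := by
    intro ω hω b hb h1
    have hm : IsMaxOn (norm ∘ fun z => magic ω (h z)) V b := fun z hz => by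
      simpa [h1] using norm_magic_le hω (hh.2 hz)
    have e := Complex.norm_eqOn_of_isPreconnected_of_isMaxOn hc hV
      ((differentiableOn_magic hω).comp hh.1 hs) hb hm ha
    simp only [Function.comp, Function.const] at e
    linarith [norm_magic_lt hω hah]
  -- Choosing `ω = conj z` gives `Φ_ω (z + w, zw) = -z`, which is unimodular.
  have main : ∀ b ∈ V, ∀ z w : ℂ, ‖z‖ = 1 → h b ≠ (z + w, z * w) := by
    intro b hb z w hz hbz
    have hzz : z * starRingEnd ℂ z = 1 := by simp [Complex.mul_conj', hz]
    refine key (starRingEnd ℂ z) (by simpa) b hb ?_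
    have hd := two_sub_ne_zero (ω := starRingEnd ℂ z) (by simpa) (hs hb)
    rw [hbz] at hd ⊢
    have : magic (starRingEnd ℂ z) (z + w, z * w) = -z := by
      rw [magic, div_eq_iff hd]
      linear_combination (w - z) * hzz
    rw [this, norm_neg, hz]
  intro b hb
  obtain ⟨z, w, hz, hw, hbz⟩ := hh.2 hb
  refine ⟨z, w, lt_of_le_of_ne hz fun h1 => main b hb z w h1 hbz,
    lt_of_le_of_ne hw fun h1 => main b hb w z h1 (by rw [hbz, add_comm, mul_comm]), hbz⟩

/-- A unimodular `z` can be pushed radially outwards to `tz`, `t > 1`; as `(s, p)` determines the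
roots `tz`, `w`, the perturbed point leaves `Γ`. -/
theorem interior_Gam_subset : interior Gam ⊆ openGam := by
  have key : ∀ z w : ℂ, ‖z‖ = 1 → (z + w, z * w) ∉ interior Gam := by
    intro z w hz hi
    have hc : Continuous fun t : ℝ => ((t * z + w, t * z * w) : ℂ × ℂ) := by fun_prop
    have h1 : ∀ᶠ t : ℝ in 𝓝[>] 1, ((t * z + w, t * z * w) : ℂ × ℂ) ∈ interior Gam :=
      (hc.continuousAt.eventually (isOpen_interior.mem_nhds (by simpa using hi))).filter_mono
        nhdsWithin_le_nhds
    obtain ⟨t, ht, ht1⟩ := (h1.and self_mem_nhdsWithin).exists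
    obtain ⟨a, b, ha, hb, hab⟩ := interior_subset ht
    simp only [Prod.mk.injEq] at hab
    have h2 : (t * z - a) * (t * z - b) = 0 := by
      linear_combination t * z * hab.1 - hab.2
    have h3 : ‖(t : ℂ) * z‖ > 1 := by
      rw [norm_mul, hz, mul_one, Complex.norm_real, Real.norm_eq_abs]
      exact lt_of_lt_of_le ht1 (le_abs_self t)
    rcases mul_eq_zero.1 h2 with h | h <;> rw [sub_eq_zero.1 h] at h3 <;> linarith
  intro x hx
  obtain ⟨z, w, hz, hw, rfl⟩ := interior_subset hx
  exact ⟨z, w, lt_of_le_of_ne hz fun h => key z w h hx,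
    lt_of_le_of_ne hw fun h => key w z h (by rwa [add_comm, mul_comm]), rfl⟩

theorem mapsTo_openGam_of_not_isSuperficial {h : ℂ → ℂ × ℂ} (hh : IsHol disc Gam h)
    (hs : ¬ IsSuperficial h) : MapsTo h disc openGam := by
  simp only [IsSuperficial, MapsTo, not_forall] at hs
  obtain ⟨a, ha, hf⟩ := hs
  refine mapsTo_openGam isOpen_ball (convex_ball 0 1).isPreconnected hh ha
    (interior_Gam_subset ?_)
  by_contra hi
  exact hf ⟨subset_closure (hh.2 ha), hi⟩

theorem isHol_magic {ω : ℂ} (hω : ‖ω‖ = 1) : IsHol openGam disc (magic ω) :=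
  ⟨(differentiableOn_magic hω).mono fun _ => norm_fst_lt,
    fun _ hx => by simpa [disc] using norm_magic_lt hω hx⟩

/-! ### Conjugate reversal and the polynomial form of `h` -/

/-- The conjugate reversal `z ^ n * conj (P (1 / conj z))` of a polynomial of degree at most `n`. -/
noncomputable def conjRev (n : ℕ) (P : ℂ[X]) : ℂ[X] := (P.map (starRingEnd ℂ)).reflect n

theorem eval_conjRev {n : ℕ} {P : ℂ[X]} (hP : P.natDegree ≤ n) {z : ℂ} (hz : z ≠ 0) :
    (conjRev n P).eval z = z ^ n * starRingEnd ℂ (P.eval (starRingEnd ℂ z)⁻¹) := by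
  have hi : z⁻¹ ≠ 0 := inv_ne_zero hz
  let _ := invertibleOfNonzero hi
  have h := eval₂_reflect_mul_pow (RingHom.id ℂ) z⁻¹ n (P.map (starRingEnd ℂ))
    (natDegree_map_le.trans hP)
  rw [invOf_eq_inv, inv_inv, eval₂_id, eval₂_id] at h
  have e : (P.map (starRingEnd ℂ)).eval z⁻¹ =
      starRingEnd ℂ (P.eval (starRingEnd ℂ z)⁻¹) := by
    rw [← eval_map_apply]
    simp
  rw [conjRev, ← e, ← h]
  rw [mul_left_comm, ← mul_pow, mul_inv_cancel₀ hz, one_pow, mul_one]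

theorem eval_conjRev_of_norm_eq_one {n : ℕ} {P : ℂ[X]} (hP : P.natDegree ≤ n) {z : ℂ}
    (hz : ‖z‖ = 1) : (conjRev n P).eval z = z ^ n * starRingEnd ℂ (P.eval z) := by
  have h0 : z ≠ 0 := fun h => by simp [h] at hz
  rw [eval_conjRev hP h0]
  congr 3
  rw [inv_eq_of_mul_eq_one_left]
  simp [Complex.mul_conj', hz]

theorem natDegree_conjRev_le {n : ℕ} {P : ℂ[X]} (hP : P.natDegree ≤ n) :
    (conjRev n P).natDegree ≤ n := by
  rw [natDegree_le_iff_coeff_eq_zero]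
  intro N hN
  rw [conjRev, coeff_reflect, revAt_eq_self_of_lt hN]
  exact coeff_eq_zero_of_natDegree_lt ((natDegree_map_le.trans hP).trans_lt hN)

theorem conjRev_mul {m n : ℕ} {P Q : ℂ[X]} (hP : P.natDegree ≤ m) (hQ : Q.natDegree ≤ n) :
    conjRev (m + n) (P * Q) = conjRev m P * conjRev n Q := by
  rw [conjRev, Polynomial.map_mul]
  exact reflect_mul _ _ (natDegree_map_le.trans hP) (natDegree_map_le.trans hQ)

theorem coeff_zero_conjRev (n : ℕ) (P : ℂ[X]) :
    (conjRev n P).coeff 0 = starRingEnd ℂ (P.coeff n) := by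
  rw [conjRev, coeff_reflect, revAt_zero, coeff_map]

theorem infinite_unit_circle : {z : ℂ | ‖z‖ = 1}.Infinite := by
  have h : InjOn (fun x : ℝ => (Circle.exp x : ℂ)) (Icc 0 1) :=
    Circle.coe_injective.comp_injOn
      (Circle.exp_injOn_Icc (by linarith [Real.two_le_pi]))
  refine ((Icc_infinite zero_lt_one).image h).mono ?_
  rintro _ ⟨x, -, rfl⟩
  exact Circle.norm_coe _

/-- Turns relations on the circle, where conjugation becomes reversal, into polynomial identities.
-/
theorem poly_eq_of_circle {P Q : ℂ[X]} (h : ∀ z : ℂ, ‖z‖ = 1 → P.eval z = Q.eval z) : P = Q :=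
  eq_of_infinite_eval_eq P Q (infinite_unit_circle.mono h)

/-- Reversal reflects the nonzero roots in the circle, so `P` has its roots outside the closed disc
and its reversal inside. -/
theorem isCoprime_conjRev {n : ℕ} {P : ℂ[X]} (hP : P.natDegree ≤ n)
    (h : ∀ z : ℂ, ‖z‖ ≤ 1 → P.eval z ≠ 0) : IsCoprime P (conjRev n P) := by
  rw [isCoprime_iff_aeval_ne_zero_of_isAlgClosed ℂ ℂ]
  intro z
  simp only [coe_aeval_eq_eval]
  by_cases hz : ‖z‖ ≤ 1
  · exact Or.inl (h z hz)
  · have h0 : z ≠ 0 := fun h => hz (by simp [h])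
    right
    rw [eval_conjRev hP h0]
    refine mul_ne_zero (pow_ne_zero _ h0) ((_root_.map_ne_zero _).2 (h _ ?_))
    rw [norm_inv, RCLike.norm_conj]
    exact inv_le_one_of_one_le₀ (not_le.1 hz).le

/-- A rational function that is unimodular on the circle and has no poles in the closed disc is a
unimodular multiple of `D̃ / D`. -/
theorem exists_conjRev_eq {N D : ℂ[X]} (hND : IsCoprime N D)
    (hD : ∀ z : ℂ, ‖z‖ ≤ 1 → D.eval z ≠ 0) (h : ∀ z : ℂ, ‖z‖ = 1 → ‖N.eval z‖ = ‖D.eval z‖) :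
    ∃ (k : ℕ) (e : ℂ), D.natDegree ≤ k ∧ ‖e‖ = 1 ∧ conjRev k D = C e * N := by
  set k := max N.natDegree D.natDegree
  have hNk : N.natDegree ≤ k := le_max_left _ _
  have hDk : D.natDegree ≤ k := le_max_right _ _
  have h1 : ‖(1 : ℂ)‖ = 1 := norm_one
  have hD1 : D.eval 1 ≠ 0 := hD 1 h1.le
  have hN1 : N.eval 1 ≠ 0 := norm_ne_zero_iff.1 (by rw [h 1 h1]; exact norm_ne_zero_iff.2 hD1)
  have hD0 : D ≠ 0 := fun h0 => by simp [h0] at hD1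
  have hN0 : N ≠ 0 := fun h0 => by simp [h0] at hN1
  have hm : N * conjRev k N = D * conjRev k D := poly_eq_of_circle fun z hz => by
    rw [eval_mul, eval_mul, eval_conjRev_of_norm_eq_one hNk hz,
      eval_conjRev_of_norm_eq_one hDk hz, mul_left_comm, Complex.mul_conj', h z hz,
      mul_left_comm, Complex.mul_conj']
  obtain ⟨E, hE⟩ : D ∣ conjRev k N := hND.symm.dvd_of_dvd_mul_left (hm ▸ dvd_mul_right D _)
  have hE' : conjRev k D = N * E := by
    refine mul_left_cancel₀ hD0 ?_
    rw [← hm, hE]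
    ring
  have hE1 : E.eval 1 ≠ 0 := fun h0 => by
    have := congrArg (eval 1) hE'
    rw [eval_conjRev_of_norm_eq_one hDk h1, eval_mul, h0] at this
    simp [hD1] at this
  have hE0 : E ≠ 0 := fun h0 => by simp [h0] at hE1
  have d1 := natDegree_conjRev_le hNk
  have d2 := natDegree_conjRev_le hDk
  rw [hE, natDegree_mul hD0 hE0] at d1
  rw [hE', natDegree_mul hN0 hE0] at d2
  -- Both `D * E` and `N * E` have degree at most `k`, and one of `D`, `N` already has degree `k`.
  have d3 : E.natDegree = 0 := by
    rcases max_choice N.natDegree D.natDegree with h' | h' <;> omega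
  rw [natDegree_eq_zero] at d3
  obtain ⟨e, rfl⟩ := d3
  refine ⟨k, e, hDk, ?_, by rw [hE', mul_comm]⟩
  have := congrArg (fun P => ‖eval 1 P‖) hE'
  simp only [eval_conjRev_of_norm_eq_one hDk h1, eval_mul, eval_C, norm_mul,
    one_pow, one_mul, RCLike.norm_conj, h 1 h1] at this
  exact (mul_eq_left₀ (norm_ne_zero_iff.2 hD1)).1 this.symm

/-- The common-denominator form of `s`, given that `s = conj s * p` on the circle. -/
theorem exists_common_denom {N D S E : ℂ[X]} {k : ℕ} {e : ℂ} (hk : D.natDegree ≤ k)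
    (he : ‖e‖ = 1) (hDN : conjRev k D = C e * N) (hSE : IsCoprime S E)
    (hD : ∀ z : ℂ, ‖z‖ ≤ 1 → D.eval z ≠ 0) (hE : ∀ z : ℂ, ‖z‖ ≤ 1 → E.eval z ≠ 0)
    (h : ∀ z : ℂ, ‖z‖ = 1 → S.eval z / E.eval z =
      starRingEnd ℂ (S.eval z / E.eval z) * (N.eval z / D.eval z)) :
    ∃ T : ℂ[X], T.natDegree ≤ k ∧ conjRev k T = C e * T ∧
      ∀ z : ℂ, ‖z‖ ≤ 1 → S.eval z / E.eval z = T.eval z / D.eval z := by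
  set m := max S.natDegree E.natDegree
  have hSm : S.natDegree ≤ m := le_max_left _ _
  have hEm : E.natDegree ≤ m := le_max_right _ _
  have hm : S * (conjRev m E * D) = E * (conjRev m S * N) := poly_eq_of_circle fun z hz => by
    have h' := h z hz
    have := hE z hz.le
    have := hD z hz.le
    have := (_root_.map_ne_zero (starRingEnd ℂ)).2 (hE z hz.le)
    rw [map_div₀] at h'
    field_simp at h'
    simp only [eval_mul, eval_conjRev_of_norm_eq_one hSm hz, eval_conjRev_of_norm_eq_one hEm hz]
    linear_combination z ^ m * h'
  -- `E` is coprime to both `S` and its own reversal, so it must divide `D`; hence `T = S * Q`.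
  obtain ⟨Q, hQ⟩ : E ∣ D := (isCoprime_conjRev hEm hE).dvd_of_dvd_mul_left
    (hSE.symm.dvd_of_dvd_mul_left (hm ▸ dvd_mul_right E _))
  have hT : ∀ z : ℂ, ‖z‖ ≤ 1 → S.eval z / E.eval z = (S * Q).eval z / D.eval z := by
    intro z hz
    have h1 := hE z hz
    have h2 := hD z hz
    rw [hQ, eval_mul] at h2 ⊢
    have h3 := right_ne_zero_of_mul h2
    rw [eval_mul]
    field_simp
  have he0 : e ≠ 0 := norm_ne_zero_iff.1 (by rw [he]; exact one_ne_zero)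
  have hc : ∀ z : ℂ, ‖z‖ = 1 →
      z ^ k * starRingEnd ℂ ((S * Q).eval z) = e * (S * Q).eval z := by
    intro z hz
    have h1 := h z hz
    rw [hT z hz.le] at h1
    have h2 := hD z hz.le
    have h3 := (_root_.map_ne_zero (starRingEnd ℂ)).2 h2
    have h4 := congrArg (eval z) hDN
    rw [eval_conjRev_of_norm_eq_one hk hz, eval_mul, eval_C] at h4
    rw [map_div₀] at h1
    field_simp at h1
    refine mul_right_cancel₀ h3 ?_
    linear_combination starRingEnd ℂ ((S * Q).eval z) * h4 - e * h1
  have hdeg : (S * Q).natDegree ≤ k := by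
    by_contra! hlt
    set M := (S * Q).natDegree
    -- If `k < M`, the coefficient of `X ^ k` is the conjugate leading coefficient of `S * Q` on the
    -- left and zero on the right.
    have h1 : X ^ k * conjRev M (S * Q) = X ^ M * (C e * (S * Q)) :=
      poly_eq_of_circle fun z hz => by
        rw [eval_mul, eval_mul, eval_mul, eval_conjRev_of_norm_eq_one le_rfl hz, eval_C,
          ← hc z hz]
        simp only [eval_pow, eval_X]
        ring
    have h2 := congrArg (fun P => coeff P k) h1
    simp only [coeff_X_pow_mul', le_refl, if_true, Nat.sub_self, coeff_zero_conjRev,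
      if_neg (not_le.2 hlt), map_eq_zero] at h2
    have h3 : S * Q = 0 := leadingCoeff_eq_zero.1 h2
    simp [M, h3] at hlt
  refine ⟨S * Q, hdeg, poly_eq_of_circle fun z hz => ?_, hT⟩
  rw [eval_conjRev_of_norm_eq_one hdeg hz, hc z hz, eval_mul (p := C e), eval_C]

/-! ### Blaschke products as quotients `B̃ / B` -/

theorem isBlaschke_const_mul_pow {c : ℂ} (hc : ‖c‖ = 1) (n : ℕ) :
    IsBlaschke n (fun z => c * z ^ n) :=
  ⟨c, fun _ => 0, hc, fun _ => by simp [disc], fun z _ => by simp⟩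

theorem IsBlaschke.const_mul {d : ℕ} {f : ℂ → ℂ} (hf : IsBlaschke d f) {c : ℂ} (hc : ‖c‖ = 1) :
    IsBlaschke d (fun z => c * f z) := by
  obtain ⟨c', α, hc', hα, h⟩ := hf
  exact ⟨c * c', α, by rw [norm_mul, hc, hc', one_mul], hα, fun z hz => by
    simp only [h z hz, mul_assoc]⟩

theorem IsBlaschke.factor_mul {d : ℕ} {f : ℂ → ℂ} (hf : IsBlaschke d f) {a : ℂ} (ha : a ∈ disc) :
    IsBlaschke (d + 1) (fun z => (z - a) / (1 - starRingEnd ℂ a * z) * f z) := by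
  obtain ⟨c, α, hc, hα, h⟩ := hf
  refine ⟨c, Fin.cons a α, hc, fun j => ?_, fun z hz => ?_⟩
  · refine Fin.cases ?_ (fun i => ?_) j
    · simpa
    · simpa using hα i
  · simp only [h z hz, Fin.prod_univ_succ, Fin.cons_zero, Fin.cons_succ]
    ring

theorem IsBlaschke.congr {d : ℕ} {f g : ℂ → ℂ} (hf : IsBlaschke d f)
    (h : ∀ z ∈ disc, g z = f z) : IsBlaschke d g := by
  obtain ⟨c, α, hc, hα, h'⟩ := hf
  exact ⟨c, α, hc, hα, fun z hz => (h z hz).trans (h' z hz)⟩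

theorem conjRev_one_X_sub_C (a : ℂ) : conjRev 1 (X - C a) = 1 - C (starRingEnd ℂ a) * X :=
  poly_eq_of_circle fun z hz => by
    rw [eval_conjRev_of_norm_eq_one (natDegree_X_sub_C a).le hz]
    simp only [pow_one, eval_sub, eval_X, eval_C, map_sub, eval_one, eval_mul]
    have : z * starRingEnd ℂ z = 1 := by simp [Complex.mul_conj', hz]
    linear_combination this

/-- The quotient `B̃ / B` is a Blaschke product; zeros of `B` on the circle lower its degree. -/
theorem exists_isBlaschke_conjRev_div (n : ℕ) : ∀ B : ℂ[X], B.natDegree ≤ n →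
    (∀ z ∈ disc, B.eval z ≠ 0) → ∃ d ≤ n, ((∃ σ : ℂ, ‖σ‖ = 1 ∧ B.eval σ = 0) → d + 1 ≤ n) ∧
      IsBlaschke d (fun z => (conjRev n B).eval z / B.eval z) := by
  induction n with
  | zero =>
    intro B hB h
    obtain ⟨b, rfl⟩ := natDegree_eq_zero.1 (Nat.le_zero.1 hB)
    have hb : b ≠ 0 := by simpa using h 0 (by simp [disc])
    refine ⟨0, le_rfl, fun ⟨σ, _, h0⟩ => absurd (by simpa using h0) hb, ?_⟩
    refine (isBlaschke_const_mul_pow (c := starRingEnd ℂ b / b) (by simp [hb]) 0).congr ?_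
    intro z _
    simp [conjRev]
  | succ n ih =>
    intro B hB h
    by_cases h0 : B.natDegree = 0
    · obtain ⟨b, rfl⟩ := natDegree_eq_zero.1 h0
      have hb : b ≠ 0 := by simpa using h 0 (by simp [disc])
      refine ⟨n + 1, le_rfl, fun ⟨σ, _, h0⟩ => absurd (by simpa using h0) hb, ?_⟩
      refine (isBlaschke_const_mul_pow (c := starRingEnd ℂ b / b) (by simp [hb]) (n + 1)).congr ?_
      intro z _
      simp only [conjRev, map_C, reflect_C, eval_mul, eval_C, eval_pow, eval_X]
      ring
    · obtain ⟨β, hβ⟩ := Complex.exists_root (f := B) (natDegree_pos_iff_degree_pos.1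
        (Nat.pos_of_ne_zero h0))
      obtain ⟨B₁, rfl⟩ := dvd_iff_isRoot.2 hβ
      have hB₁ : ∀ z ∈ disc, B₁.eval z ≠ 0 := fun z hz h0 => h z hz (by simp [h0])
      have hB₁0 : B₁ ≠ 0 := fun h0 => hB₁ 0 (by simp [disc]) (by simp [h0])
      have hdeg : B₁.natDegree ≤ n := by
        rw [natDegree_mul (X_sub_C_ne_zero β) hB₁0, natDegree_X_sub_C] at hB
        omega
      have hβ1 : 1 ≤ ‖β‖ := by
        by_contra! hlt
        exact h β (by simpa [disc] using hlt) (by simp)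
      have hβ0 : β ≠ 0 := fun h0 => by simp [h0] at hβ1; linarith
      have hβ0' : starRingEnd ℂ β ≠ 0 := (_root_.map_ne_zero _).2 hβ0
      have hrev : conjRev (n + 1) ((X - C β) * B₁) =
          (1 - C (starRingEnd ℂ β) * X) * conjRev n B₁ := by
        rw [add_comm n 1, conjRev_mul (natDegree_X_sub_C β).le hdeg, conjRev_one_X_sub_C]
      obtain ⟨d, hd, hd', hbl⟩ := ih B₁ hdeg hB₁
      rcases hβ1.eq_or_lt with h1 | h1
      -- For `|β| = 1` the factor `(1 - conj β z) / (z - β)` is the constant `-conj β`: this is the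
      -- drop in degree.
      · refine ⟨d, hd.trans n.le_succ, fun _ => by omega, ?_⟩
        refine (hbl.const_mul (c := -starRingEnd ℂ β) (by simp [← h1])).congr fun z hz => ?_
        have e1 := h z hz
        have e2 := hB₁ z hz
        have hββ : starRingEnd ℂ β * β = 1 := by simp [Complex.conj_mul', ← h1]
        simp only [hrev, eval_mul, eval_sub, eval_one, eval_C, eval_X] at e1 ⊢
        have e3 := left_ne_zero_of_mul e1
        field_simp
        linear_combination (-eval z (conjRev n B₁)) * hββ
      -- For `|β| > 1` the same factor is a unimodular multiple of the Blaschke factor with zero `1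
      -- / conj β`.
      · have ha : (starRingEnd ℂ β)⁻¹ ∈ disc := by
          simpa [disc] using inv_lt_one_of_one_lt₀ h1
        refine ⟨d + 1, by omega, ?_, ?_⟩
        · rintro ⟨σ, hσ, hσ0⟩
          refine Nat.succ_le_succ (hd' ⟨σ, hσ, ?_⟩)
          rw [eval_mul] at hσ0
          refine (mul_eq_zero.1 hσ0).resolve_left fun h' => ?_
          rw [eval_sub, eval_X, eval_C, sub_eq_zero] at h'
          rw [← h', hσ] at h1
          exact lt_irrefl _ h1
        · refine ((hbl.factor_mul ha).const_mul (c := starRingEnd ℂ β / β)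
            (by simp [hβ0])).congr fun z hz => ?_
          have e1 := h z hz
          have e2 := hB₁ z hz
          simp only [hrev, eval_mul, eval_sub, eval_one, eval_C, eval_X, map_inv₀,
            Complex.conj_conj] at e1 ⊢
          have e3 := left_ne_zero_of_mul e1
          have e4 : 1 - β⁻¹ * z ≠ 0 := by
            intro h'
            apply e3
            field_simp at h'
            linear_combination -h'
          have e5 : β - z ≠ 0 := fun h' => e3 (by linear_combination -h')
          field_simp
          ring

/-! ### Interpolating a Blaschke product by a strict contraction -/

theorem exists_prod_sub_mul_eq {V : Set ℂ} (hV : IsOpen V) (L : Finset ℂ) {F : ℂ → ℂ}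
    (hF : DifferentiableOn ℂ F V) (hL : ∀ a ∈ L, a ∈ V ∧ F a = 0) :
    ∃ G : ℂ → ℂ, DifferentiableOn ℂ G V ∧ ∀ z ∈ V, F z = (∏ a ∈ L, (z - a)) * G z := by
  classical
  induction L using Finset.induction_on with
  | empty => exact ⟨F, hF, by simp⟩
  | insert a L ha ih =>
    obtain ⟨G, hG, hFG⟩ := ih fun b hb => hL b (Finset.mem_insert_of_mem hb)
    obtain ⟨haV, hFa⟩ := hL a (Finset.mem_insert_self a L)
    have hGa : G a = 0 := by
      rw [hFG a haV] at hFa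
      refine (mul_eq_zero.1 hFa).resolve_left (Finset.prod_ne_zero_iff.2 fun b hb => ?_)
      exact sub_ne_zero.2 fun h => ha (h ▸ hb)
    refine ⟨dslope G a, (Complex.differentiableOn_dslope (hV.mem_nhds haV)).2 hG, fun z hz => ?_⟩
    have := sub_smul_dslope G a z
    rw [hGa, sub_zero, smul_eq_mul] at this
    rw [hFG z hz, Finset.prod_insert ha, ← this]
    ring

theorem one_sub_conj_mul_ne_zero {a z : ℂ} (ha : a ∈ disc) (hz : ‖z‖ ≤ 1) :
    1 - starRingEnd ℂ a * z ≠ 0 := by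
  intro h
  have h1 : ‖starRingEnd ℂ a * z‖ = 1 := by rw [← sub_eq_zero.1 h, norm_one]
  rw [norm_mul, RCLike.norm_conj] at h1
  have h2 : ‖a‖ < 1 := by simpa [disc] using ha
  have := mul_le_of_le_one_right (norm_nonneg a) hz
  linarith

theorem one_sub_conj_mul_eq {a z : ℂ} (hz : ‖z‖ = 1) :
    1 - starRingEnd ℂ a * z = z * starRingEnd ℂ (z - a) := by
  have : z * starRingEnd ℂ z = 1 := by simp [Complex.mul_conj', hz]
  rw [map_sub]
  linear_combination -this

/-- A function that is holomorphic and of modulus less than one near the closed disc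
cannot agree with a Blaschke product of degree `d` at more than `d` points. -/
theorem card_le_of_eqOn_isBlaschke {R : ℝ} (hR : 1 < R) {f b : ℂ → ℂ} {d : ℕ}
    (hf : DifferentiableOn ℂ f (ball 0 R)) (hf1 : ∀ z ∈ ball (0 : ℂ) R, ‖f z‖ < 1)
    (hb : IsBlaschke d b) {L : Finset ℂ} (hL : ∀ a ∈ L, a ∈ disc) (hfb : ∀ a ∈ L, f a = b a) :
    L.card ≤ d := by
  by_contra! hlt
  obtain ⟨L', hL', hcard⟩ := Finset.exists_subset_card_eq (Nat.succ_le_of_lt hlt)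
  obtain ⟨c, α, hc, hα, h⟩ := hb
  have hball : closedBall (0 : ℂ) 1 ⊆ ball 0 R := closedBall_subset_ball hR
  set P : ℂ → ℂ := fun z => ∏ j, (z - α j)
  set P' : ℂ → ℂ := fun z => ∏ j, (1 - starRingEnd ℂ (α j) * z)
  set Q : ℂ → ℂ := fun z => ∏ a ∈ L', (z - a)
  set Q' : ℂ → ℂ := fun z => ∏ a ∈ L', (1 - starRingEnd ℂ a * z)
  have hP'0 : ∀ z, ‖z‖ ≤ 1 → P' z ≠ 0 := fun z hz =>
    Finset.prod_ne_zero_iff.2 fun j _ => one_sub_conj_mul_ne_zero (hα j) hz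
  have hQ'0 : ∀ z, ‖z‖ ≤ 1 → Q' z ≠ 0 := fun z hz =>
    Finset.prod_ne_zero_iff.2 fun a ha => one_sub_conj_mul_ne_zero (hL a (hL' ha)) hz
  have hP' : ∀ z, ‖z‖ = 1 → P' z = z ^ d * starRingEnd ℂ (P z) := fun z hz => by
    simp [P, P', one_sub_conj_mul_eq hz, Finset.prod_mul_distrib, map_prod]
  have hQ' : ∀ z, ‖z‖ = 1 → Q' z = z ^ (d + 1) * starRingEnd ℂ (Q z) := fun z hz => by
    simp [Q, Q', one_sub_conj_mul_eq hz, Finset.prod_mul_distrib, map_prod, hcard]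
  have hPd : Differentiable ℂ P := by fun_prop
  have hP'd : Differentiable ℂ P' := by fun_prop
  have hQ'd : Differentiable ℂ Q' := by fun_prop
  -- On `𝔻` the function being factored is `P'² (f - b)`, so it vanishes on the `d + 1` points of
  -- `L'`.
  obtain ⟨G, hG, hFG⟩ := exists_prod_sub_mul_eq isOpen_ball L'
    (F := fun z => f z * P' z ^ 2 - c * P z * P' z)
    ((hf.mul (hP'd.pow 2).differentiableOn).sub
      ((hPd.const_mul c).mul hP'd).differentiableOn) (fun a ha => by
        have ha1 := hL a (hL' ha)
        have ha2 : ‖a‖ < 1 := by simpa [disc] using ha1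
        refine ⟨ball_subset_ball hR.le ha1, ?_⟩
        have hp := hP'0 a ha2.le
        have hfa : f a = c * (P a / P' a) := by
          rw [hfb a (hL' ha), h a ha1, Finset.prod_div_distrib]
        simp only [hfa]
        field_simp
        ring)
  -- The factor `z` gives `H 0 = 0` and balances `z ^ d` from `P'` against `z ^ (d + 1)` from `Q'`.
  -- On the circle `H = w - ρ` with `|w| = |f| ρ < ρ`, so `Re H < 0` there, contradicting the
  -- maximum principle for `exp H`.
  set H : ℂ → ℂ := fun z => starRingEnd ℂ c * z * G z / Q' z
  have hH : DifferentiableOn ℂ H (closedBall 0 1) :=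
    ((differentiableOn_id.const_mul _).mul (hG.mono hball)).div hQ'd.differentiableOn
      fun z hz => hQ'0 z (by simpa using hz)
  obtain ⟨z, hz, hmax⟩ := Complex.exists_mem_frontier_isMaxOn_norm
    (f := fun z => Complex.exp (H z)) (isBounded_ball (x := (0 : ℂ)) (r := 1)) ⟨0, by simp⟩
    (DifferentiableOn.diffContOnCl (by rw [closure_ball _ one_ne_zero]; exact hH.cexp))
  have hz1 : ‖z‖ = 1 := by simpa [frontier_ball] using hz
  have h0 : (1 : ℝ) ≤ ‖Complex.exp (H z)‖ := by
    have := hmax (subset_closure (by simp : (0 : ℂ) ∈ ball 0 1))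
    simpa [H] using this
  rw [Complex.norm_exp, ← Real.exp_zero, Real.exp_le_exp] at h0
  have hzz : z * starRingEnd ℂ z = 1 := by simp [Complex.mul_conj', hz1]
  have hcc : starRingEnd ℂ c * c = 1 := by simp [Complex.conj_mul', hc]
  have hz0 : z ≠ 0 := left_ne_zero_of_mul (hzz.symm ▸ one_ne_zero)
  have hP0 : P z ≠ 0 := fun h0 => hP'0 z hz1.le (by rw [hP' z hz1, h0]; simp)
  have hQ0 : Q z ≠ 0 := fun h0 => hQ'0 z hz1.le (by rw [hQ' z hz1, h0]; simp)
  have hQc0 : starRingEnd ℂ (Q z) ≠ 0 := (_root_.map_ne_zero _).2 hQ0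
  have hzR : z ∈ ball (0 : ℂ) R := hball (by simp [hz1])
  set ρ : ℝ := ‖P z‖ ^ 2 / ‖Q z‖ ^ 2
  have hρ : 0 < ρ := by positivity
  have hρ' : (ρ : ℂ) = P z * starRingEnd ℂ (P z) / (Q z * starRingEnd ℂ (Q z)) := by
    simp [ρ, Complex.mul_conj']
  set w : ℂ := starRingEnd ℂ c * f z * z ^ d * starRingEnd ℂ (P z) ^ 2 /
    (Q z * starRingEnd ℂ (Q z))
  have hw : ‖w‖ < ρ := by
    have : ‖w‖ = ‖f z‖ * ρ := by
      simp only [w, ρ, norm_div, norm_mul, norm_pow, RCLike.norm_conj, hc, hz1]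
      ring
    rw [this]
    exact mul_lt_of_lt_one_left hρ (hf1 z hzR)
  have hHz : H z = w - ρ := by
    have e := hFG z hzR
    rw [hP' z hz1] at e
    rw [hρ']
    simp only [H, w, hQ' z hz1]
    have e' : G z = (f z * (z ^ d * starRingEnd ℂ (P z)) ^ 2 -
        c * P z * (z ^ d * starRingEnd ℂ (P z))) / Q z := by
      rw [eq_div_iff hQ0, mul_comm]; exact e.symm
    rw [e']
    field_simp
    linear_combination (-(z * z ^ d * starRingEnd ℂ (P z) * P z)) * hcc
  rw [hHz, Complex.sub_re, Complex.ofReal_re] at h0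
  linarith [Complex.re_le_norm w]

/-! ### Absence of poles, and the degree of `h` -/

/-- A rational function that is bounded on the disc has no poles in the closed disc. -/
theorem denom_eval_ne_zero_of_bounded {r : RatFunc ℂ} {M : ℝ}
    (h : ∀ z ∈ disc, ‖r.eval (RingHom.id ℂ) z‖ ≤ M) {z : ℂ} (hz : ‖z‖ ≤ 1) :
    r.denom.eval z ≠ 0 := by
  intro h0
  have hfin : {w : ℂ | r.denom.eval w = 0}.Finite := by
    refine r.denom.roots.toFinset.finite_toSet.subset fun w hw => ?_
    simpa [r.denom_ne_zero] using hw
  have hd : Dense {w : ℂ | r.denom.eval w = 0}ᶜ := hfin.countable.dense_compl ℝ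
  have hcl : z ∈ closure (disc ∩ {w : ℂ | r.denom.eval w = 0}ᶜ) := by
    refine closure_minimal (hd.open_subset_closure_inter isOpen_ball) isClosed_closure ?_
    rw [closure_ball _ one_ne_zero]
    simpa using hz
  -- At a pole `RatFunc.eval` returns `0`, so the bound is informative only off the poles; in
  -- product form it extends to them by continuity and forces a common zero.
  have hle : ‖r.num.eval z‖ ≤ M * ‖r.denom.eval z‖ := by
    refine le_on_closure (s := disc ∩ {w : ℂ | r.denom.eval w = 0}ᶜ)
      (f := fun w => ‖r.num.eval w‖) (g := fun w => M * ‖r.denom.eval w‖) ?_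
      (by fun_prop) (by fun_prop) hcl
    intro w hw
    have h1 := h w hw.1
    simp only [RatFunc.eval, eval₂_id, norm_div] at h1
    exact (div_le_iff₀ (norm_pos_iff.2 hw.2)).1 h1
  rw [h0, norm_zero, mul_zero, norm_le_zero_iff] at hle
  have := (isCoprime_iff_aeval_ne_zero_of_isAlgClosed ℂ ℂ _ _).1 r.isCoprime_num_denom z
  simp [h0, hle] at this

/-- The degree of `p` on the circle, when `p = c z ^ k conj D / D`. -/
theorem degree_eq_of_conjRev {s p : RatFunc ℂ} {D : ℂ[X]} {n : ℤ} {k : ℕ} {c : ℂ}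
    (hdeg : HasDegree (ratMap s p) n) (hc : ‖c‖ = 1) (hk : D.natDegree ≤ k)
    (hD : ∀ z : ℂ, ‖z‖ ≤ 1 → D.eval z ≠ 0)
    (hp : ∀ z : ℂ, ‖z‖ = 1 →
      p.eval (RingHom.id ℂ) z = c * (conjRev k D).eval z / D.eval z) : n = k := by
  obtain ⟨f, hf, hfn⟩ := hdeg
  have hsnd : ∀ x ∈ bGam, ‖x.2‖ = 1 := by
    rintro _ ⟨z, w, hz, hw, rfl⟩
    simp [hz, hw]
  let π : C(bGam, Circle) :=
    ⟨fun x => ⟨x.1.2, mem_sphere_zero_iff_norm.2 (hsnd x.1 x.2)⟩, by fun_prop⟩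
  have h1 : (π.comp f).Homotopic (π.comp (coreLoop n)) :=
    (ContinuousMap.Homotopic.refl π).comp hfn
  have hD' : ∀ (t : unitInterval) (z : Circle), D.eval ((t : ℝ) * (z : ℂ)) ≠ 0 := fun t z => by
    refine hD _ ?_
    rw [norm_mul, Circle.norm_coe, mul_one, Complex.norm_real, Real.norm_of_nonneg t.2.1]
    exact t.2.2
  -- Shrinking the argument of `D` to `0`, which meets no zero, deforms `p` on the circle to a
  -- constant times `z ^ k`.
  let φ : unitInterval × Circle → ℂ := fun x =>
    c * (x.2 : ℂ) ^ k * (starRingEnd ℂ (D.eval ((x.1 : ℝ) * (x.2 : ℂ))) /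
      D.eval ((x.1 : ℝ) * (x.2 : ℂ)))
  have hφ1 : ∀ x, ‖φ x‖ = 1 := fun x => by
    simp only [φ]
    rw [norm_mul, norm_mul, norm_pow, Circle.norm_coe, norm_div, RCLike.norm_conj, hc,
      div_self (norm_ne_zero_iff.2 (hD' _ _)), one_pow, one_mul, one_mul]
  have hφ : Continuous φ := by
    have h2 : Continuous fun x : unitInterval × Circle => D.eval ((x.1 : ℝ) * (x.2 : ℂ)) := by
      fun_prop
    exact Continuous.mul (by fun_prop)
      ((Complex.continuous_conj.comp h2).div h2 fun x => hD' x.1 x.2)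
  let K : C(unitInterval × Circle, Circle) :=
    ⟨fun x => ⟨φ x, mem_sphere_zero_iff_norm.2 (hφ1 x)⟩, hφ.subtype_mk _⟩
  let H : ContinuousMap.Homotopy (K.comp ⟨fun z => (0, z), by fun_prop⟩) (π.comp f) :=
    { toContinuousMap := K
      map_zero_left := fun z => rfl
      map_one_left := fun z => by
        apply Circle.ext
        change φ (1, z) = (f z : ℂ × ℂ).2
        rw [hf z]
        simp only [ratMap, φ]
        rw [hp z (Circle.norm_coe z), eval_conjRev_of_norm_eq_one hk (Circle.norm_coe z),
          Set.Icc.coe_one, Complex.ofReal_one, one_mul]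
        ring }
  have h2 := ContinuousMap.Homotopic.trans ⟨H⟩ h1
  obtain ⟨a, ha⟩ : ∃ a : Circle, (a : ℂ) = c * (starRingEnd ℂ (D.eval 0) / D.eval 0) :=
    ⟨⟨_, mem_sphere_zero_iff_norm.2 (by simp [hc, hD 0 (by simp)])⟩, rfl⟩
  refine (eq_of_homotopic_zpow (c := a) (m := k) (fun z => ?_) (fun z => ?_) h2).symm
  · apply Circle.ext
    rw [zpow_natCast]
    change φ (0, z) = ((a * z ^ k : Circle) : ℂ)
    rw [Circle.coe_mul, Circle.coe_pow, ha]
    simp only [φ]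
    rw [Set.Icc.coe_zero, Complex.ofReal_zero, zero_mul]
    ring
  · exact Circle.ext rfl

/-! ### Extremality and the main theorem -/

/-- A map into `𝒢` whose composition with some `Φ_ω` is a Blaschke product of degree `d` is
`N`-extremal for `N > d`. -/
theorem isExtremal_of_isBlaschke_magic {h : ℂ → ℂ × ℂ} (hh : IsHol disc Gam h)
    (hG : MapsTo h disc openGam) {ω : ℂ} (hω : ‖ω‖ = 1) {d N : ℕ} (hdN : d < N)
    (hb : IsBlaschke d (magic ω ∘ h)) : IsExtremal Gam N h := by
  classical
  refine ⟨hh, fun lam hinj hlam => ⟨⟨h, hh, fun _ => rfl⟩, ?_⟩⟩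
  rintro ⟨U, hU, hUd, g, hg, hgh⟩
  rw [disc, closure_ball _ one_ne_zero] at hUd
  obtain ⟨δ, hδ, hδU⟩ := (isCompact_closedBall (0 : ℂ) 1).exists_thickening_subset_open hU hUd
  rw [thickening_closedBall hδ zero_le_one] at hδU
  have hg' : IsHol (ball 0 (δ + 1)) Gam g := ⟨hg.1.mono hδU, hg.2.mono_left hδU⟩
  have hsub : disc ⊆ ball 0 (δ + 1) := ball_subset_ball (by linarith)
  -- `N > d` supplies at least one node; there `g` agrees with `h` and so meets `𝒢`.
  have hgG := mapsTo_openGam isOpen_ball (convex_ball 0 (δ + 1)).isPreconnected hg'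
    (hsub (hlam ⟨0, by omega⟩)) (by rw [hgh]; exact hG (hlam _))
  have := card_le_of_eqOn_isBlaschke (R := δ + 1) (by linarith) (f := magic ω ∘ g)
    (L := Finset.univ.image lam) ((isHol_magic hω).1.comp hg'.1 hgG)
    (fun z hz => norm_magic_lt hω (hgG hz)) hb (by simpa using hlam) (by simp [hgh])
  rw [Finset.card_image_of_injective _ hinj, Finset.card_univ, Fintype.card_fin] at this
  omega

end SymBidisc

theorem mainTheorem9 (s p : RatFunc ℂ) (n : ℕ)
    (hinner : SymBidisc.IsGammaInner (SymBidisc.ratMap s p))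
    (hdeg : SymBidisc.HasDegree (SymBidisc.ratMap s p) (n : ℤ))
    (hsup : ¬ SymBidisc.IsSuperficial (SymBidisc.ratMap s p))
    (hroyal : ¬ MapsTo (SymBidisc.ratMap s p) SymBidisc.disc SymBidisc.royal) :
    (SymBidisc.IsExtremal SymBidisc.Gam (n + 1) (SymBidisc.ratMap s p) ∧
      SymBidisc.IsComplexGeodesic SymBidisc.openGam n (SymBidisc.ratMap s p)) ∧
    ((∃ σ : ℂ, ‖σ‖ = 1 ∧ SymBidisc.IsRoyalNode (SymBidisc.ratMap s p) σ) →
      SymBidisc.IsExtremal SymBidisc.Gam n (SymBidisc.ratMap s p) ∧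
      ∃ m : ℕ, m + 1 = n ∧
        SymBidisc.IsComplexGeodesic SymBidisc.openGam m (SymBidisc.ratMap s p)) := by
  open SymBidisc Polynomial in
  have hG := mapsTo_openGam_of_not_isSuperficial hinner.1 hsup
  have hDs : ∀ z : ℂ, ‖z‖ ≤ 1 → s.denom.eval z ≠ 0 := fun z hz =>
    denom_eval_ne_zero_of_bounded (M := 2) (fun w hw => norm_fst_le (hinner.1.2 hw)) hz
  have hDp : ∀ z : ℂ, ‖z‖ ≤ 1 → p.denom.eval z ≠ 0 := fun z hz =>
    denom_eval_ne_zero_of_bounded (M := 1) (fun w hw => norm_snd_le (hinner.1.2 hw)) hz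
  have hs : ∀ z : ℂ, (ratMap s p z).1 = s.num.eval z / s.denom.eval z := fun z => by
    simp [ratMap, RatFunc.eval]
  have hp : ∀ z : ℂ, (ratMap s p z).2 = p.num.eval z / p.denom.eval z := fun z => by
    simp [ratMap, RatFunc.eval]
  have hbd : ∀ z : ℂ, ‖z‖ = 1 → ratMap s p z ∈ bGam := fun z hz => by
    obtain ⟨f, hf, -⟩ := hdeg
    have := hf ⟨z, mem_sphere_zero_iff_norm.2 hz⟩
    exact this ▸ (f _).2
  have hp1 : ∀ z : ℂ, ‖z‖ = 1 → ‖p.num.eval z‖ = ‖p.denom.eval z‖ := fun z hz => by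
    obtain ⟨a, b, ha, hb, hab⟩ := hbd z hz
    have h1 : ‖p.num.eval z / p.denom.eval z‖ = 1 := by rw [← hp, hab]; simp [ha, hb]
    rw [norm_div] at h1
    exact eq_of_div_eq_one h1
  obtain ⟨k, e, hk, he, hDN⟩ := exists_conjRev_eq p.isCoprime_num_denom hDp hp1
  obtain ⟨T, hTk, hTrev, hT⟩ := exists_common_denom hk he hDN s.isCoprime_num_denom hDp hDs
    (fun z hz => by
      obtain ⟨a, b, ha, hb, hab⟩ := hbd z hz
      rw [← hs, ← hp, hab]
      have h1 : starRingEnd ℂ a * a = 1 := by simp [Complex.conj_mul', ha]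
      have h2 : starRingEnd ℂ b * b = 1 := by simp [Complex.conj_mul', hb]
      simp only [map_add]
      linear_combination (-b) * h1 - a * h2)
  have he0 : e ≠ 0 := norm_ne_zero_iff.1 (by rw [he]; exact one_ne_zero)
  have hnk : n = k := by
    have : (n : ℤ) = k := degree_eq_of_conjRev (c := e⁻¹) hdeg (by simp [he]) hk hDp fun z hz => by
      rw [hDN, eval_mul, eval_C, inv_mul_cancel_left₀ he0]
      exact hp z
    exact_mod_cast this
  subst hnk
  have key : ∀ ω : ℂ, ‖ω‖ = 1 → ∃ d ≤ n,
      ((∃ σ : ℂ, ‖σ‖ = 1 ∧ ω * (ratMap s p σ).1 = 2) → d + 1 ≤ n) ∧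
        IsBlaschke d (magic ω ∘ ratMap s p) := by
    intro ω hω
    have hωω : starRingEnd ℂ ω * ω = 1 := by simp [Complex.conj_mul', hω]
    -- `B` is the denominator of `Φ_ω ∘ h` after clearing `D`; the symmetries of `D` and `T` make
    -- its reversal a multiple of the numerator.
    set B : ℂ[X] := C 2 * p.denom - C ω * T
    have hBn : B.natDegree ≤ n := (natDegree_sub_le _ _).trans
      (max_le ((natDegree_C_mul_le _ _).trans hk) ((natDegree_C_mul_le _ _).trans hTk))
    have hB : ∀ z : ℂ, ‖z‖ ≤ 1 → B.eval z = p.denom.eval z * (2 - ω * (ratMap s p z).1) := by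
      intro z hz
      have := hDp z hz
      rw [hs, hT z hz]
      simp only [B, eval_sub, eval_mul, eval_C]
      field_simp
    have hrev : conjRev n B = C (e * starRingEnd ℂ ω) * (C (2 * ω) * p.num - T) :=
      poly_eq_of_circle fun z hz => by
        have h1 := congrArg (eval z) hDN
        have h2 := congrArg (eval z) hTrev
        rw [eval_conjRev_of_norm_eq_one hk hz, eval_mul, eval_C] at h1
        rw [eval_conjRev_of_norm_eq_one hTk hz, eval_mul, eval_C] at h2
        rw [eval_conjRev_of_norm_eq_one hBn hz]
        simp only [B, eval_sub, eval_mul, eval_C, map_sub, map_mul, Complex.conj_ofNat]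
        linear_combination 2 * h1 - starRingEnd ℂ ω * h2 - 2 * e * p.num.eval z * hωω
    have hB0 : ∀ z ∈ disc, B.eval z ≠ 0 := fun z hz => by
      have hz1 : ‖z‖ ≤ 1 := by simpa [disc] using (ball_subset_closedBall hz)
      rw [hB z hz1]
      exact mul_ne_zero (hDp z hz1) (two_sub_ne_zero hω (norm_fst_lt (hG hz)))
    obtain ⟨d, hd, hd', hbl⟩ := exists_isBlaschke_conjRev_div n B hBn hB0
    refine ⟨d, hd, ?_, ?_⟩
    · rintro ⟨σ, hσ, h2⟩
      exact hd' ⟨σ, hσ, by rw [hB σ hσ.le, h2, sub_self, mul_zero]⟩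
    · refine (hbl.const_mul (c := e⁻¹ * ω) (by simp [he, hω])).congr fun z hz => ?_
      have hz1 : ‖z‖ ≤ 1 := by simpa [disc] using (ball_subset_closedBall hz)
      have h1 := hDp z hz1
      have h2 := two_sub_ne_zero hω (norm_fst_lt (hG hz))
      simp only [Function.comp, magic]
      rw [hB z hz1, hrev, ← mul_div_assoc, div_eq_div_iff h2 (mul_ne_zero h1 h2)]
      have h3 : T.eval z = p.denom.eval z * (ratMap s p z).1 := by
        rw [hs, hT z hz1]; field_simp
      have h4 : p.num.eval z = p.denom.eval z * (ratMap s p z).2 := by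
        rw [hp]; field_simp
      simp only [eval_sub, eval_mul, eval_C, h3, h4]
      have h5 : e⁻¹ * e = 1 := inv_mul_cancel₀ he0
      generalize (ratMap s p z).1 = a at *
      generalize (ratMap s p z).2 = b at *
      have h6 : e⁻¹ * ω * (e * starRingEnd ℂ ω) = 1 := by
        linear_combination ω * starRingEnd ℂ ω * h5 + hωω
      linear_combination (-(p.denom.eval z * (2 * ω * b - a) * (2 - ω * a))) * h6
  have hHol : IsHol disc openGam (ratMap s p) := ⟨hinner.1.1, hG⟩
  constructor
  · obtain ⟨d, hd, -, hb⟩ := key 1 norm_one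
    exact ⟨isExtremal_of_isBlaschke_magic hinner.1 hG norm_one (Nat.lt_succ_of_le hd) hb,
      hHol, magic 1, isHol_magic norm_one, d, hd, hb⟩
  · rintro ⟨σ, hσ, -, z, hz⟩
    have hz1 : ‖z‖ = 1 := by
      obtain ⟨a, b, ha, hb, hab⟩ := hbd σ hσ
      have h1 : ‖z ^ 2‖ = ‖a * b‖ := by
        have := congrArg Prod.snd (hz.symm.trans hab)
        exact congrArg norm this
      rw [norm_pow, norm_mul, ha, hb, one_mul] at h1
      exact (pow_eq_one_iff_of_nonneg (norm_nonneg z) two_ne_zero).1 h1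
    -- With `ω = conj z` one has `ω s(σ) = 2`, so `B` vanishes at `σ`.
    have hω : ‖starRingEnd ℂ z‖ = 1 := by simpa
    obtain ⟨d, -, hd, hb⟩ := key _ hω
    have hdn := hd ⟨σ, hσ, by
      have : starRingEnd ℂ z * z = 1 := by simp [Complex.conj_mul', hz1]
      rw [hz]
      linear_combination 2 * this⟩
    exact ⟨isExtremal_of_isBlaschke_magic hinner.1 hG hω hdn hb, n - 1, by omega,
      hHol, magic _, isHol_magic hω, d, by omega, hb⟩
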